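/- **Setting.** Let $\mathcal A$ be a unital $C^*$-algebra with state space $\mathcal S\subset\mathcal A^*$, endowed with the weak$^*$ topology. A *quantum filtering model* consists of the following data. * A one-parameter semigroup $\{P_t\}_{t\ge 0}$ of contractive, completely positive linear maps $P_t:\mathcal A\to\mathcal A$ with $P_0=\mathrm{id}$ and $P_t[I]=I$. * A von Neumann algebra $\mathfrak M$ acting on a Hilbert space, and an increasing family of von Neumann subalgebras $\mathfrak M_{t]}\subset\mathfrak M$, $t\ge 0$, with $(\bigcup_{t}\mathfrak M_{t]})''=\mathfrak M$ and such that $\mathfrak M_{0]}\simeq\mathcal A^{**}$ is the enveloping von Neumann algebra of $\mathcal A$ (with respect to the map $j_0$ below). * Normal states $\Phi_\rho$ on $\mathfrak M$, $\rho\in\mathcal S$, such that for all $t\ge0$ and $\rho\in\mathcal S$ there is a conditional expectation $\Phi_\rho(\,\cdot\,|\mathfrak M_{t]}):\mathfrak M\to\mathfrak M_{t]}$, that is, a linear, unital, positive, $^*$-preserving map with $\Phi_\rho(XYZ|\mathfrak M_{t]})=X\,\Phi_\rho(Y|\mathfrak M_{t]})\,Z$ for $Y\in\mathfrak M$, $X,Z\in\mathfrak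 M_{t]}$, and $\Phi_\rho(\Phi_\rho(X|\mathfrak M_{t]}))=\Phi_\rho(X)$ for $X\in\mathfrak M$. Identities $X=Y$ between conditional expectations are understood up to $\Phi_\rho$-indistinguishability, i.e. $\Phi_\rho(|X-Y|^2)=0$. * Injective unital $^*$-homomorphisms $j_t:\mathcal A\to\mathfrak M_{t]}$, $t\ge 0$, with $\Phi_\rho(j_{t+s}(X)|\mathfrak M_{s]})=j_s(P_t[X])$ for all $s,t\ge 0$, $X\in\mathcal A$, $\rho\in\mathcal S$ (Markov property), $j_0(\mathcal A)''=\mathfrak M_{0]}$, and $\Phi_\rho(j_0(X))=\rho(X)$. * Self-adjoint operators $Y_t^k$, $t\ge0$, $k=1,\dots,n$, with $Y^k_t$ affiliated to $\mathfrak M_{t]}$ and $Y_0^k=0$ (the observations), such that the von Neumann algebra $\mathfrak Y_{t]}$ generated by $\{Y_s^k:0\le s\le t,\ 1\le k\le n\}$ is commutative and $j_t(\mathcal A)\subset\mathfrak Y_{t]}'$ for all $t\ge 0$. * (Feller-type property.) For all $t_1,\dots,t_m>0$, $k_1,\dots,k_m\in\{1,\dots,n\}$ and bounded continuous $f_1,\dots,f_m:\mathbb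 R\to\mathbb R$ there is $Z\in\mathcal A$, not depending on $\rho$ or $s$, such that for all $\rho\in\mathcal S$ and $s\ge 0$ $$\Phi_\rho\big(f_1(Y^{k_1}_{t_1})\cdots f_m(Y^{k_m}_{t_m})\,\big|\,\mathfrak M_{0]}\big)=j_0(Z),\qquad \Phi_\rho\big(f_1(Y^{k_1}_{s+t_1}-Y^{k_1}_s)\cdots f_m(Y^{k_m}_{s+t_m}-Y^{k_m}_s)\,\big|\,\mathfrak M_{s]}\big)=j_s(Z),$$ where the differences denote the closures of the differences of operators. Let $\mathfrak Y=(\bigcup_{t\ge0}\mathfrak Y_{t]})''$. For $\rho_1,\rho_2\in\mathcal S$, the law of the observations under $\Phi_{\rho_1}$ is *absolutely continuous* with respect to the law of the observations under $\Phi_{\rho_2}$ if every projection $Q\in\mathfrak Y$ with $\Phi_{\rho_2}(Q)=0$ satisfies $\Phi_{\rho_1}(Q)=0$. A state $\rho\in\mathcal S$ is the *barycenter* of a regular Borel probability measure $\mu$ on $\mathcal S$ if $\rho(X)=\int_{\mathcal S}\varphi(X)\,\mu(d\varphi)$ for all $X\in\mathcal A$. Write $\rho_1\ll\rho_2$ if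 there are regular Borel probability measures $\mu_1\ll\mu_2$ on $\mathcal S$ such that $\rho_i$ is the barycenter of $\mu_i$, $i=1,2$. **Proposition.** Let $\rho_1,\rho_2\in\mathcal S$ be such that $\rho_1\ll\rho_2$. Then the law of the observations under $\Phi_{\rho_1}$ is absolutely continuous with respect to the law of the observations under $\Phi_{\rho_2}$. -/

import Mathlib

open MeasureTheory
open scoped ComplexOrder InnerProductSpace NNReal CStarAlgebra BoundedContinuousFunction

noncomputable section

namespace QuantumFiltering

universe u v

/-! ### States of a unital C*-algebra, barycenters, absolute continuity -/

section States

variable (A : Type u) [CStarAlgebra A]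

/-- The state space of a unital C*-algebra, as a subset of the dual with the weak* topology. -/
def stateSpace : Set (WeakDual ℂ A) :=
  {φ | φ 1 = 1 ∧ ∀ a : A, 0 ≤ φ (star a * a)}

/-- The Borel σ-algebra of the weak* topology on the state space. -/
instance instMeasurableSpaceStateSpace : MeasurableSpace (stateSpace A) := borel _

instance instBorelSpaceStateSpace : BorelSpace (stateSpace A) := ⟨rfl⟩

variable {A}

/-- `ρ` is the barycenter of the measure `μ` on the state space. -/
def IsBarycenter (ρ : stateSpace A) (μ : Measure (stateSpace A)) : Prop :=
  ∀ X : A, ρ.1 X = ∫ φ : stateSpace A, φ.1 X ∂μ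

/-- Absolute continuity of states in the sense of randomizations: the states are barycenters of
regular Borel probability measures `μ₁ ≪ μ₂` on the state space. -/
def StateAbsolutelyContinuous (ρ₁ ρ₂ : stateSpace A) : Prop :=
  ∃ μ₁ μ₂ : Measure (stateSpace A),
    IsProbabilityMeasure μ₁ ∧ IsProbabilityMeasure μ₂ ∧ μ₁.Regular ∧ μ₂.Regular ∧
    IsBarycenter ρ₁ μ₁ ∧ IsBarycenter ρ₂ μ₂ ∧ μ₁ ≪ μ₂

end States

variable {H : Type v} [NormedAddCommGroup H] [InnerProductSpace ℂ H] [CompleteSpace H]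

/-! ### Normal states and conditional expectations on a von Neumann algebra -/

/-- A normal state on the von Neumann algebra `M`: a positive unital linear functional which is
σ-weakly continuous, i.e. of the form `X ↦ ∑ₙ ⟪ξₙ, X ηₙ⟫` with square-summable `ξ`, `η`. -/
structure IsNormalState (M : VonNeumannAlgebra H) (Φ : M.toStarSubalgebra →ₗ[ℂ] ℂ) : Prop where
  map_one : Φ 1 = 1
  nonneg : ∀ X : M.toStarSubalgebra, 0 ≤ Φ (star X * X)
  normal : ∃ ξ η : ℕ → H, Summable (fun k => ‖ξ k‖ ^ 2) ∧ Summable (fun k => ‖η k‖ ^ 2) ∧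
    ∀ X : M.toStarSubalgebra, HasSum (fun k => ⟪ξ k, (X : H →L[ℂ] H) (η k)⟫_ℂ) (Φ X)

/-- `E` is a conditional expectation from `M` onto the von Neumann subalgebra `N` with respect
to the state `Φ`. -/
structure IsCondExp (M N : VonNeumannAlgebra H) (Φ : M.toStarSubalgebra →ₗ[ℂ] ℂ)
    (E : M.toStarSubalgebra →ₗ[ℂ] M.toStarSubalgebra) : Prop where
  mem : ∀ X, (E X : H →L[ℂ] H) ∈ N
  map_one : E 1 = 1
  positive : ∀ X, ContinuousLinearMap.IsPositive (E (star X * X) : H →L[ℂ] H)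
  map_star : ∀ X, E (star X) = star (E X)
  module : ∀ X Y Z : M.toStarSubalgebra, (X : H →L[ℂ] H) ∈ N → (Z : H →L[ℂ] H) ∈ N →
    E (X * Y * Z) = X * E Y * Z
  expectation : ∀ X, Φ (E X) = Φ X

/-- `Φ`-indistinguishability, `Φ(|X - Y|²) = 0`. -/
def Indistinguishable {M : VonNeumannAlgebra H} (Φ : M.toStarSubalgebra →ₗ[ℂ] ℂ)
    (X Y : M.toStarSubalgebra) : Prop :=
  Φ (star (X - Y) * (X - Y)) = 0

/-! ### Unbounded self-adjoint operators -/

/-- The bounded operator `T` commutes with the unbounded operator `Y`, i.e. `T Y ⊆ Y T`. -/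
def CommutesWith (T : H →L[ℂ] H) (Y : H →ₗ.[ℂ] H) : Prop :=
  ∀ ψ : Y.domain, ∃ h : T ψ ∈ Y.domain, Y ⟨T ψ, h⟩ = T (Y ψ)

/-- The closed operator `Y` is affiliated to the von Neumann algebra `M`: it commutes with every
bounded operator in the commutant of `M`. -/
def IsAffiliated (Y : H →ₗ.[ℂ] H) (M : VonNeumannAlgebra H) : Prop :=
  ∀ T ∈ M.commutant, CommutesWith T Y

/-- The von Neumann algebra generated by a set `S` of (self-adjoint) unbounded operators: the
commutant of the algebra of all `T` such that `T` and `T*` commute with every `Y ∈ S`. It is the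
smallest von Neumann algebra to which all `Y ∈ S` are affiliated. -/
def generatedBy (S : Set (H →ₗ.[ℂ] H)) : VonNeumannAlgebra H where
  toStarSubalgebra := StarSubalgebra.centralizer ℂ
    {T : H →L[ℂ] H | ∀ Y ∈ S, CommutesWith T Y ∧ CommutesWith (star T) Y}
  centralizer_centralizer' := by simp

/-- `R = (Y + i)⁻¹`: the bounded operator `R` is a two-sided inverse of `Y + i`. -/
def IsResolvent (Y : H →ₗ.[ℂ] H) (R : H →L[ℂ] H) : Prop :=
  (∀ ψ : H, ∃ h : R ψ ∈ Y.domain, Y ⟨R ψ, h⟩ + Complex.I • R ψ = ψ) ∧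
  ∀ ψ : Y.domain, R (Y ψ + Complex.I • (ψ : H)) = ψ

/-- `B = f(Y)` for a self-adjoint operator `Y` and a bounded continuous function `f`.
With the normal operator `R = (Y + i)⁻¹` one has `R* R = (1 + Y²)⁻¹`, which has dense range, so
`f(Y)` is the unique bounded operator with `f(Y) (1 + Y²)⁻¹ = g(Y)`, where
`g(x) = f(x) / (1 + x²)` vanishes at infinity. The right-hand side is given by the continuous
functional calculus of `R`: if `z = (x + i)⁻¹`, then `re z⁻¹ = x` and `|z|² = (1 + x²)⁻¹`, and
`z ↦ f (re z⁻¹) |z|²` is continuous, with value `0` at `z = 0`. -/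
def IsFunctionOf (Y : H →ₗ.[ℂ] H) (f : ℝ →ᵇ ℝ) (B : H →L[ℂ] H) : Prop :=
  ∃ R : H →L[ℂ] H, IsResolvent Y R ∧
    B * (star R * R) = cfc (fun z : ℂ => ((f (z⁻¹).re * ‖z‖ ^ 2 : ℝ) : ℂ)) R

/-- The bounded operator `f(Y)`. -/
def applyFun (f : ℝ →ᵇ ℝ) (Y : H →ₗ.[ℂ] H) : H →L[ℂ] H :=
  Classical.epsilon (IsFunctionOf Y f)

/-! ### The quantum filtering model -/

/-- A quantum filtering model with initial system `A`, acting on the Hilbert space `H`, with an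
`n`-dimensional observation process. -/
structure FilteringModel (A : Type u) [CStarAlgebra A] [PartialOrder A] [StarOrderedRing A]
    (H : Type v) [NormedAddCommGroup H] [InnerProductSpace ℂ H] [CompleteSpace H] (n : ℕ) where
  /-- the semigroup on the initial system -/
  P : ℝ≥0 → (A →CP A)
  P_contractive : ∀ t X, ‖P t X‖ ≤ ‖X‖
  P_zero : ∀ X, P 0 X = X
  P_add : ∀ s t X, P (s + t) X = P s (P t X)
  P_one : ∀ t, P t 1 = 1
  /-- the universal algebra -/
  M : VonNeumannAlgebra H
  /-- the filtration -/
  Mt : ℝ≥0 → VonNeumannAlgebra H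
  Mt_mono : Monotone Mt
  Mt_le : ∀ t, Mt t ≤ M
  Mt_generate : Set.centralizer (Set.centralizer (⋃ t, (Mt t : Set (H →L[ℂ] H)))) = M
  /-- the family of normal states -/
  Φ : stateSpace A → (M.toStarSubalgebra →ₗ[ℂ] ℂ)
  Φ_normal : ∀ ρ, IsNormalState M (Φ ρ)
  /-- the conditional expectations (a version of each) -/
  E : stateSpace A → ℝ≥0 → (M.toStarSubalgebra →ₗ[ℂ] M.toStarSubalgebra)
  E_isCondExp : ∀ ρ t, IsCondExp M (Mt t) (Φ ρ) (E ρ t)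
  /-- the signal process -/
  j : ℝ≥0 → (A →⋆ₐ[ℂ] M.toStarSubalgebra)
  j_injective : ∀ t, Function.Injective (j t)
  j_mem : ∀ t X, (j t X : H →L[ℂ] H) ∈ Mt t
  markov : ∀ (ρ : stateSpace A) (t s : ℝ≥0) (X : A),
    Indistinguishable (Φ ρ) (E ρ s (j (t + s) X)) (j s (P t X))
  j_zero_generates : Set.centralizer (Set.centralizer
    (Set.range fun X : A => (j 0 X : H →L[ℂ] H))) = (Mt 0 : Set (H →L[ℂ] H))
  /-- `Mt 0` is the enveloping von Neumann algebra of `A`, i.e. `A** ≃ Mt 0` compatibly with the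
  inclusion of `A` -/
  enveloping : ∃ θ : StrongDual ℂ (StrongDual ℂ A) →ₗᵢ[ℂ] (H →L[ℂ] H),
    Set.range θ = (Mt 0 : Set (H →L[ℂ] H)) ∧
    ∀ X : A, θ (NormedSpace.inclusionInDoubleDual ℂ A X) = j 0 X
  initial : ∀ (ρ : stateSpace A) (X : A), Φ ρ (j 0 X) = ρ.1 X
  /-- the observation process -/
  Y : ℝ≥0 → Fin n → (H →ₗ.[ℂ] H)
  Y_selfAdjoint : ∀ t k, IsSelfAdjoint (Y t k)
  Y_affiliated : ∀ t k, IsAffiliated (Y t k) (Mt t)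
  Y_zero : ∀ k, Y 0 k = 0
  /-- the self-nondemolition property -/
  selfNondemolition : ∀ t,
    ∀ S ∈ generatedBy {y | ∃ s ≤ t, ∃ k, y = Y s k},
    ∀ T ∈ generatedBy {y | ∃ s ≤ t, ∃ k, y = Y s k}, S * T = T * S
  /-- the nondemolition property -/
  nondemolition : ∀ (t : ℝ≥0) (X : A),
    (j t X : H →L[ℂ] H) ∈ (generatedBy {y | ∃ s ≤ t, ∃ k, y = Y s k}).commutant
  /-- the Feller-type property; `Z` depends neither on the state nor on the time shift, and the
  difference of observations is understood as the closure of the algebraic difference -/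
  feller : ∀ (m : ℕ) (t : Fin m → ℝ≥0) (κ : Fin m → Fin n) (f : Fin m → (ℝ →ᵇ ℝ)),
    (∀ i, 0 < t i) → ∃ Z : A, ∀ ρ : stateSpace A,
      (∀ X : M.toStarSubalgebra,
        (X : H →L[ℂ] H) = (List.ofFn fun i => applyFun (f i) (Y (t i) (κ i))).prod →
        Indistinguishable (Φ ρ) (E ρ 0 X) (j 0 Z)) ∧
      ∀ (s : ℝ≥0) (X : M.toStarSubalgebra),
        (X : H →L[ℂ] H) = (List.ofFn fun i =>
          applyFun (f i) (Y (s + t i) (κ i) - Y s (κ i)).closure).prod →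
        Indistinguishable (Φ ρ) (E ρ s X) (j s Z)

namespace FilteringModel

variable {A : Type u} [CStarAlgebra A] [PartialOrder A] [StarOrderedRing A] {n : ℕ}

/-- The von Neumann algebra generated by the observations up to time `t`. -/
def obsUpTo (𝓕 : FilteringModel A H n) (t : ℝ≥0) : VonNeumannAlgebra H :=
  generatedBy {y | ∃ s ≤ t, ∃ k, y = 𝓕.Y s k}

/-- The von Neumann algebra `(⋃ₜ 𝔜ₜ)''` generated by all observations. -/
def obs (𝓕 : FilteringModel A H n) : Set (H →L[ℂ] H) :=
  Set.centralizer (Set.centralizer (⋃ t, (𝓕.obsUpTo t : Set (H →L[ℂ] H))))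

/-- The law of the observations under `Φ ρ₁` is absolutely continuous with respect to the law of
the observations under `Φ ρ₂`. -/
def ObsLawAbsolutelyContinuous (𝓕 : FilteringModel A H n) (ρ₁ ρ₂ : stateSpace A) : Prop :=
  ∀ Q : 𝓕.M.toStarSubalgebra, (Q : H →L[ℂ] H) ∈ 𝓕.obs → IsStarProjection Q →
    𝓕.Φ ρ₂ Q = 0 → 𝓕.Φ ρ₁ Q = 0

end FilteringModel

end QuantumFiltering

end

/-! The Feller-type property, conditioned on time `0`, turns the expectation of a product of bounded
continuous functions of the observations into `ρ(Z)`, with one `Z : A` serving all initial states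
`ρ`. By linearity this holds on the commutative *-algebra generated by the real and imaginary parts
of the resolvents `(Y_t + i)⁻¹`, `t > 0` (`exists_apply_eq`), and this algebra has every observable
projection `Q` in its double commutant (`commute_of_mem_obs`).

A Kaplansky-type density argument, elementary because the algebra is commutative, approximates `Q`
on finitely many vectors by elements `a` of the algebra with `-ε ≤ a ≤ 1 + ε`
(`exists_mem_approx_of_isStarProjection`). Normality then gives `Z_m` with `ρ_i(Z_m) → Φ_{ρ_i}(Q)`
for the two given states, while positivity of all `Φ_φ` confines `φ(Z_m)` to `[-δ_m, 1 + δ_m]` for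
every state `φ`.

If `Φ_{ρ₂}(Q) = 0`, the nonnegative functions `φ ↦ φ(Z_m) + δ_m` tend to `0` in `L¹(μ₂)`, so a
subsequence tends to `0` almost everywhere for `μ₂`, hence for `μ₁`. Dominated convergence yields
`Φ_{ρ₁}(Q) = 0`. The function `φ ↦ Φ_φ(Q)` itself is never integrated, so no regularity of it is
needed. -/

noncomputable section

namespace QuantumFiltering

universe u v

/-! ### Resolvents of unbounded self-adjoint operators -/

section Resolvent

variable {H : Type v} [NormedAddCommGroup H] [InnerProductSpace ℂ H]

/-- `R` is a two-sided inverse of `Y + c`. -/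
def IsResolventAt (Y : H →ₗ.[ℂ] H) (c : ℂ) (R : H →L[ℂ] H) : Prop :=
  (∀ ψ : H, ∃ h : R ψ ∈ Y.domain, Y ⟨R ψ, h⟩ + c • R ψ = ψ) ∧
  ∀ ψ : Y.domain, R (Y ψ + c • (ψ : H)) = ψ

namespace IsResolventAt

variable {Y : H →ₗ.[ℂ] H} {c : ℂ} {R R' T : H →L[ℂ] H}

theorem unique (h : IsResolventAt Y c R) (h' : IsResolventAt Y c R') : R = R' := by
  ext x
  obtain ⟨hm, hx⟩ := h'.1 x
  have := h.2 ⟨R' x, hm⟩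
  rwa [hx] at this

/-- First resolvent identity. At the points `±i` it yields normality of `(Y + i)⁻¹` and the location
of its spectrum. -/
theorem sub_eq {d : ℂ} (h : IsResolventAt Y c R) (h' : IsResolventAt Y d R') :
    R' - R = (c - d) • (R' * R) := by
  ext x
  obtain ⟨hm, hx⟩ := h.1 x
  have h1 := h'.2 ⟨R x, hm⟩
  have h2 : x = (Y ⟨R x, hm⟩ + d • R x) + (c - d) • R x := by
    rw [sub_smul]; nth_rw 1 [← hx]; abel
  have h3 : R' x = R x + (c - d) • R' (R x) := by
    nth_rw 1 [h2]; rw [map_add, map_smul, h1]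
  simp [h3]

theorem injective (h : IsResolventAt Y c R) : Function.Injective R := by
  refine (injective_iff_map_eq_zero _).mpr fun x hx => ?_
  obtain ⟨hm, hx'⟩ := h.1 x
  have : (⟨R x, hm⟩ : Y.domain) = 0 := Subtype.ext hx
  rw [← hx', this, hx]; simp

/-- This replaces domain questions about `Y` by commutation of bounded operators. -/
theorem commutesWith_iff (h : IsResolventAt Y c R) : CommutesWith T Y ↔ T * R = R * T := by
  constructor
  · intro hT
    ext x
    obtain ⟨hm, hx⟩ := h.1 x
    obtain ⟨hm', hx'⟩ := hT ⟨R x, hm⟩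
    have h1 := h.2 ⟨T (R x), hm'⟩
    have h2 : Y ⟨T (R x), hm'⟩ + c • T (R x) = T x := by
      rw [hx', ← map_smul, ← map_add, hx]
    simp only [mul_apply_eq_comp]
    rw [← h2, h1]
  · intro hT ψ
    have hT' (x : H) : T (R x) = R (T x) := congrArg (fun S : H →L[ℂ] H => S x) hT
    obtain ⟨hm, hx⟩ := h.1 (T (Y ψ + c • (ψ : H)))
    have h1 : R (T (Y ψ + c • (ψ : H))) = T ψ := by rw [← hT', h.2]
    refine ⟨h1 ▸ hm, ?_⟩
    simp only [h1] at hx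
    have h2 : T (Y ψ + c • (ψ : H)) = T (Y ψ) + c • T ψ := by rw [map_add, map_smul]
    replace hx := hx.trans h2
    exact add_right_cancel hx

end IsResolventAt

theorem IsResolvent.isResolventAt {Y : H →ₗ.[ℂ] H} {R : H →L[ℂ] H} (h : IsResolvent Y R) :
    IsResolventAt Y Complex.I R := h

variable [CompleteSpace H]

theorem inner_map_left_of_isSelfAdjoint {Y : H →ₗ.[ℂ] H} (hY : IsSelfAdjoint Y)
    (x y : Y.domain) : ⟪Y x, (y : H)⟫_ℂ = ⟪(x : H), Y y⟫_ℂ := by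
  have h := LinearPMap.adjoint_isFormalAdjoint hY.dense_domain
  rw [LinearPMap.isSelfAdjoint_def.mp hY] at h
  exact h x y

/-- Symmetry makes `⟪Y x, x⟫` real and `c` is purely imaginary, so the cross term has real part
zero. -/
theorem norm_map_add_smul_sq {Y : H →ₗ.[ℂ] H} (hY : IsSelfAdjoint Y) {c : ℂ}
    (hc : star c = -c) (hc1 : ‖c‖ = 1) (x : Y.domain) :
    ‖Y x + c • (x : H)‖ ^ 2 = ‖Y x‖ ^ 2 + ‖(x : H)‖ ^ 2 := by
  have key : RCLike.re ⟪Y x, c • (x : H)⟫_ℂ = 0 := by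
    have h1 : star ⟪Y x, c • (x : H)⟫_ℂ = -⟪Y x, c • (x : H)⟫_ℂ := by
      rw [inner_smul_right, star_mul', hc, inner_map_left_of_isSelfAdjoint hY]
      have : star ⟪(x : H), Y x⟫_ℂ = ⟪Y x, (x : H)⟫_ℂ := inner_conj_symm _ _
      rw [this, inner_map_left_of_isSelfAdjoint hY]
      ring
    have h2 := congrArg Complex.re h1
    simp only [Complex.star_def, Complex.conj_re, Complex.neg_re] at h2
    change (⟪Y x, c • (x : H)⟫_ℂ).re = 0
    linarith
  rw [norm_add_sq (𝕜 := ℂ), key, norm_smul, hc1]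
  ring

/-- The graph of `Y` is complete, and the norm identity bounds `Y + c` below on it. Hence `Y + c` is
injective with closed range, and only density of the range remains. -/
theorem exists_isResolventAt {Y : H →ₗ.[ℂ] H} (hY : IsSelfAdjoint Y) {c : ℂ}
    (hc : star c = -c) (hc1 : ‖c‖ = 1) : ∃ R, IsResolventAt Y c R := by
  have : CompleteSpace Y.graph := hY.isClosed.completeSpace_coe
  let g : Y.graph →L[ℂ] H :=
    (ContinuousLinearMap.snd ℂ H H + c • ContinuousLinearMap.fst ℂ H H).comp Y.graph.subtypeL
  have hg (x : Y.domain) : g ⟨((x : H), Y x), Y.mem_graph x⟩ = Y x + c • (x : H) := rfl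
  have hrep (p : Y.graph) : ∃ x : Y.domain, p = ⟨((x : H), Y x), Y.mem_graph x⟩ := by
    obtain ⟨⟨a, b⟩, hp⟩ := p
    obtain ⟨x, hx, hx'⟩ := (LinearPMap.mem_graph_iff Y).mp hp
    exact ⟨x, by simp_all⟩
  have hbound (p : Y.graph) : ‖p‖ ≤ (1 : ℝ≥0) * ‖g p‖ := by
    obtain ⟨x, rfl⟩ := hrep p
    rw [hg, NNReal.coe_one, one_mul]
    have h := norm_map_add_smul_sq hY hc hc1 x
    change max ‖(x : H)‖ ‖Y x‖ ≤ _
    refine max_le ?_ ?_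
    · exact abs_le_of_sq_le_sq' (by nlinarith [sq_nonneg ‖Y x‖]) (norm_nonneg _) |>.2
    · exact abs_le_of_sq_le_sq' (by nlinarith [sq_nonneg ‖(x : H)‖]) (norm_nonneg _) |>.2
  have hanti := g.antilipschitz_of_bound hbound
  have hker : g.ker = ⊥ := LinearMap.ker_eq_bot.mpr hanti.injective
  have hclosed : IsClosed (g.range : Set H) := hanti.isClosed_range g.uniformContinuous
  have hrange : g.range = ⊤ := by
    have : CompleteSpace g.range := hclosed.completeSpace_coe
    -- A vector orthogonal to the range lies in the domain of `Y* = Y` and is an eigenvector for the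
    -- imaginary number `c`, so it vanishes by symmetry.
    rw [← Submodule.orthogonal_eq_bot_iff, Submodule.eq_bot_iff]
    intro y hy
    have hy' (x : Y.domain) : ⟪c • y, (x : H)⟫_ℂ = ⟪y, Y x⟫_ℂ := by
      have h := (Submodule.mem_orthogonal' _ _).mp hy _ ⟨⟨((x : H), Y x), Y.mem_graph x⟩, rfl⟩
      change ⟪y, Y x + c • (x : H)⟫_ℂ = 0 at h
      rw [inner_add_right, inner_smul_right] at h
      rw [inner_smul_left]
      change star c * _ = _
      rw [hc]
      linear_combination -h
    have hmem : y ∈ Y.domain := by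
      have := LinearPMap.mem_adjoint_domain_of_exists (T := Y) y ⟨_, hy'⟩
      rwa [LinearPMap.isSelfAdjoint_def.mp hY] at this
    have hYy : Y ⟨y, hmem⟩ = c • y := by
      refine hY.dense_domain.eq_of_inner_left ℂ fun z hz => ?_
      rw [hy' ⟨z, hz⟩]
      exact inner_map_left_of_isSelfAdjoint hY ⟨y, hmem⟩ ⟨z, hz⟩
    have h := inner_map_left_of_isSelfAdjoint hY ⟨y, hmem⟩ ⟨y, hmem⟩
    rw [hYy, inner_smul_left, inner_smul_right] at h
    change star c * _ = _ at h
    rw [hc] at h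
    have hc0 : c ≠ 0 := by rintro rfl; simp at hc1
    have h2 : c * ⟪y, y⟫_ℂ = 0 := by linear_combination -h / 2
    exact inner_self_eq_zero.mp ((mul_eq_zero.mp h2).resolve_left hc0)
  let e := ContinuousLinearEquiv.ofBijective g hker hrange
  refine ⟨((ContinuousLinearMap.fst ℂ H H).comp Y.graph.subtypeL).comp e.symm.toContinuousLinearMap,
    fun ψ => ?_, fun ψ => ?_⟩
  · obtain ⟨x, hx⟩ := hrep (e.symm ψ)
    have h1 : ((ContinuousLinearMap.fst ℂ H H).comp Y.graph.subtypeL).comp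
        e.symm.toContinuousLinearMap ψ = (x : H) := congrArg (fun p : Y.graph => p.1.1) hx
    have h2 : g (e.symm ψ) = ψ := e.apply_symm_apply ψ
    rw [hx, hg] at h2
    refine ⟨h1 ▸ x.2, ?_⟩
    simp only [h1]
    exact h2
  · have h2 : e.symm (g ⟨((ψ : H), Y ψ), Y.mem_graph ψ⟩) = _ := e.symm_apply_apply _
    exact congrArg (fun p : Y.graph => p.1.1) h2

theorem IsResolventAt.star_isResolventAt {Y : H →ₗ.[ℂ] H} {c : ℂ} {R R' : H →L[ℂ] H}
    (hY : IsSelfAdjoint Y) (hc : star c = -c) (h : IsResolventAt Y c R)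
    (hR' : IsResolventAt Y (-c) R') : star R = R' := by
  refine ((ContinuousLinearMap.eq_adjoint_iff _ _).mpr fun x y => ?_).symm
  obtain ⟨hm, hx⟩ := hR'.1 x
  obtain ⟨hn, hy⟩ := h.1 y
  nth_rw 1 [← hy]
  nth_rw 2 [← hx]
  rw [inner_add_right, inner_add_left, inner_smul_left, inner_smul_right,
    ← inner_map_left_of_isSelfAdjoint hY ⟨R' x, hm⟩ ⟨R y, hn⟩]
  change _ = _ + star (-c) * _
  rw [star_neg, hc, neg_neg]

theorem exists_isResolvent {Y : H →ₗ.[ℂ] H} (hY : IsSelfAdjoint Y) : ∃ R, IsResolvent Y R :=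
  exists_isResolventAt hY (by simp) (by simp)

namespace IsResolvent

variable {Y : H →ₗ.[ℂ] H} {R : H →L[ℂ] H}

theorem isResolventAt_star (hY : IsSelfAdjoint Y) (h : IsResolvent Y R) :
    IsResolventAt Y (-Complex.I) (star R) := by
  obtain ⟨R', hR'⟩ := exists_isResolventAt hY (c := -Complex.I) (by simp) (by simp)
  rwa [h.isResolventAt.star_isResolventAt hY (by simp) hR']

theorem star_sub_self (hY : IsSelfAdjoint Y) (h : IsResolvent Y R) :
    star R - R = (2 * Complex.I) • (star R * R) := by
  rw [h.isResolventAt.sub_eq (h.isResolventAt_star hY)]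
  congr 1; ring

theorem isStarNormal (hY : IsSelfAdjoint Y) (h : IsResolvent Y R) : IsStarNormal R := by
  have h1 := h.star_sub_self hY
  have h2 := (h.isResolventAt_star hY).sub_eq h.isResolventAt
  have h3 : (2 * Complex.I) • (star R * R) = (2 * Complex.I) • (R * star R) := by
    rw [← h1, ← neg_sub, h2, ← neg_smul]
    congr 1; ring
  exact ⟨smul_right_injective _ (by simp) h3⟩

/-- The circle `|z|² = -im z` is the closure of the image of the real line under `x ↦ (x + i)⁻¹`;
its equation is `star_sub_self` read through the functional calculus. -/
theorem eqOn_spectrum (hY : IsSelfAdjoint Y) (h : IsResolvent Y R) :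
    ∀ z ∈ spectrum ℂ R, ‖z‖ ^ 2 = -z.im := by
  have := h.isStarNormal hY
  have h1 : cfc (fun z : ℂ => star z - z) R = cfc (fun z : ℂ => (2 * Complex.I) • (star z * z)) R := by
    rw [cfc_sub .., cfc_smul .., cfc_mul .., cfc_star .., cfc_id' ℂ R]
    exact h.star_sub_self hY
  intro z hz
  have h2 := (cfc_eq_cfc_iff_eqOn (a := R)).mp h1 hz
  have h3 := congrArg Complex.im h2
  simp [Complex.mul_im] at h3
  rw [Complex.sq_norm, Complex.normSq_apply]
  linarith

/-- An operator is determined by its product with `R* R = (1 + Y²)⁻¹`. -/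
theorem mul_right_cancel (hY : IsSelfAdjoint Y) (h : IsResolvent Y R) {B B' : H →L[ℂ] H}
    (hB : B * (star R * R) = B' * (star R * R)) : B = B' := by
  -- Injectivity of the adjoint stands in for density of the range of `R* R`.
  have hinj : Function.Injective ⇑(star (star R * R) : H →L[ℂ] H) := by
    rw [star_mul, star_star]
    exact (h.isResolventAt_star hY).injective.comp h.isResolventAt.injective
  have h1 : star (star R * R) * star (B - B') = 0 := by
    rw [← star_mul, sub_mul, hB, sub_self, star_zero]
  have h2 : star (B - B') = 0 := by
    ext x
    apply hinj
    simpa using congrArg (fun S : H →L[ℂ] H => S x) h1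
  exact sub_eq_zero.mp (star_eq_zero.mp h2)

/-- `applyFun` is an unspecified choice; uniqueness of the resolvent and cancellation of `R* R`
determine its value. -/
theorem applyFun_eq (hY : IsSelfAdjoint Y) (h : IsResolvent Y R) {f : ℝ →ᵇ ℝ} {B : H →L[ℂ] H}
    (hB : B * (star R * R) = cfc (fun z : ℂ => ((f (z⁻¹).re * ‖z‖ ^ 2 : ℝ) : ℂ)) R) :
    applyFun f Y = B := by
  have hs : IsFunctionOf Y f (applyFun f Y) :=
    Classical.epsilon_spec (p := IsFunctionOf Y f) ⟨B, R, h, hB⟩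
  obtain ⟨R', hR', hB'⟩ := hs
  obtain rfl : R = R' := h.isResolventAt.unique hR'.isResolventAt
  exact h.mul_right_cancel hY (hB'.trans hB.symm)

end IsResolvent

/-- The bounded continuous function `x ↦ x / (1 + x²)`. -/
def resolventRe : ℝ →ᵇ ℝ :=
  BoundedContinuousFunction.ofNormedAddCommGroup (fun x : ℝ => x / (1 + x ^ 2))
    (by fun_prop (disch := intro x; positivity)) 1 (fun x => by
      rw [Real.norm_eq_abs, abs_div, abs_of_pos (by positivity : 0 < 1 + x ^ 2), div_le_one (by positivity)]
      nlinarith [sq_abs x, sq_nonneg (|x| - 1)])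

/-- The bounded continuous function `x ↦ 1 / (1 + x²)`. -/
def resolventIm : ℝ →ᵇ ℝ :=
  BoundedContinuousFunction.ofNormedAddCommGroup (fun x : ℝ => 1 / (1 + x ^ 2))
    (by fun_prop (disch := intro x; positivity)) 1 (fun x => by
      rw [Real.norm_eq_abs, abs_of_pos (by positivity), div_le_one (by positivity)]
      nlinarith [sq_nonneg x])

/-- For `z = (x + i)⁻¹` one has `x = re z⁻¹` and `re z = x / (1 + x²)`. The point `z = 0`,
corresponding to `x = ∞`, is separate: both sides vanish there. -/
theorem resolventRe_inv_mul {z : ℂ} (hz : ‖z‖ ^ 2 = -z.im) :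
    resolventRe (z⁻¹).re * ‖z‖ ^ 2 = z.re * ‖z‖ ^ 2 := by
  by_cases h0 : z = 0
  · simp [h0]
  change (z⁻¹).re / (1 + (z⁻¹).re ^ 2) * _ = _
  have h1 : Complex.normSq z = -z.im := by rw [← Complex.sq_norm, hz]
  have h2 : z.im ≠ 0 := by
    intro h; rw [h, neg_zero] at h1; exact h0 (Complex.normSq_eq_zero.mp h1)
  have h3 : z.re ^ 2 = -z.im - z.im ^ 2 := by rw [Complex.normSq_apply] at h1; linarith
  rw [Complex.inv_re, h1]
  have h4 : 1 + (z.re / -z.im) ^ 2 = -1 / z.im := by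
    field_simp; rw [h3]; ring
  rw [h4]
  field_simp

theorem resolventIm_inv_mul {z : ℂ} (hz : ‖z‖ ^ 2 = -z.im) :
    resolventIm (z⁻¹).re * ‖z‖ ^ 2 = ‖z‖ ^ 2 * ‖z‖ ^ 2 := by
  by_cases h0 : z = 0
  · simp [h0]
  change 1 / (1 + (z⁻¹).re ^ 2) * _ = _
  have h1 : Complex.normSq z = -z.im := by rw [← Complex.sq_norm, hz]
  have h2 : z.im ≠ 0 := by
    intro h; rw [h, neg_zero] at h1; exact h0 (Complex.normSq_eq_zero.mp h1)
  have h3 : z.re ^ 2 = -z.im - z.im ^ 2 := by rw [Complex.normSq_apply] at h1; linarith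
  rw [Complex.inv_re, h1]
  have h4 : 1 + (z.re / -z.im) ^ 2 = -1 / z.im := by
    field_simp; rw [h3]; ring
  rw [h4, hz]
  field_simp

namespace IsResolvent

variable {Y : H →ₗ.[ℂ] H} {R : H →L[ℂ] H}

theorem star_mul_self_eq_cfc (hY : IsSelfAdjoint Y) (h : IsResolvent Y R) :
    star R * R = cfc (fun z : ℂ => ((‖z‖ ^ 2 : ℝ) : ℂ)) R := by
  have := h.isStarNormal hY
  have h1 : (fun z : ℂ => ((‖z‖ ^ 2 : ℝ) : ℂ)) = fun z => star z * z := by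
    ext z; simp [Complex.conj_mul']
  rw [h1, cfc_mul .., cfc_star .., cfc_id' ℂ R]

theorem applyFun_resolventIm (hY : IsSelfAdjoint Y) (h : IsResolvent Y R) :
    applyFun resolventIm Y = star R * R := by
  have := h.isStarNormal hY
  refine h.applyFun_eq hY ?_
  rw [h.star_mul_self_eq_cfc hY, ← cfc_mul ..]
  refine cfc_congr fun z hz => ?_
  rw [resolventIm_inv_mul (h.eqOn_spectrum hY z hz)]
  push_cast; rfl

theorem applyFun_resolventRe (hY : IsSelfAdjoint Y) (h : IsResolvent Y R) :
    applyFun resolventRe Y = (1 / 2 : ℂ) • (star R + R) := by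
  have := h.isStarNormal hY
  refine h.applyFun_eq hY ?_
  have h1 : (1 / 2 : ℂ) • (star R + R) = cfc (fun z : ℂ => (1 / 2 : ℂ) • (star z + z)) R := by
    rw [cfc_smul .., cfc_add .., cfc_star .., cfc_id' ℂ R]
  rw [h1, h.star_mul_self_eq_cfc hY, ← cfc_mul ..]
  refine cfc_congr fun z hz => ?_
  rw [resolventRe_inv_mul (h.eqOn_spectrum hY z hz), Complex.star_def, add_comm, Complex.add_conj]
  simp

/-- Since `(x + i)⁻¹ = x / (1 + x²) - i / (1 + x²)`, two real functions of `Y`, to which the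
Feller-type property applies, recover the resolvent. -/
theorem eq_applyFun (hY : IsSelfAdjoint Y) (h : IsResolvent Y R) :
    R = applyFun resolventRe Y - Complex.I • applyFun resolventIm Y := by
  rw [h.applyFun_resolventIm hY, h.applyFun_resolventRe hY]
  have h1 := h.star_sub_self hY
  have h2 : star R = R + (2 * Complex.I) • (star R * R) := by rw [← h1]; abel
  generalize star R * R = N at *
  rw [h2]
  module

end IsResolvent

end Resolvent

/-! ### Density in the double commutant -/

section Density

variable {H : Type v} [NormedAddCommGroup H] [InnerProductSpace ℂ H]
variable {ι : Type*} [Fintype ι]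

/-- The diagonal action of a bounded operator on a finite power of the Hilbert space. -/
def diagonal (ι : Type*) [Fintype ι] (a : H →L[ℂ] H) :
    PiLp 2 (fun _ : ι => H) →L[ℂ] PiLp 2 (fun _ : ι => H) where
  toFun x := WithLp.toLp 2 fun i => a (x i)
  map_add' x y := by ext i; simp
  map_smul' c x := by ext i; simp
  cont := by fun_prop

@[simp] theorem diagonal_apply (a : H →L[ℂ] H) (x : PiLp 2 (fun _ : ι => H)) (i : ι) :
    diagonal ι a x i = a (x i) := rfl

variable [CompleteSpace H]

theorem inner_diagonal_left (a : H →L[ℂ] H) (x y : PiLp 2 (fun _ : ι => H)) :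
    ⟪diagonal ι (star a) x, y⟫_ℂ = ⟪x, diagonal ι a y⟫_ℂ := by
  simp [PiLp.inner_apply, ContinuousLinearMap.star_eq_adjoint,
    ContinuousLinearMap.adjoint_inner_left]

/-- The closure of the orbit of a vector in a finite power under the diagonal action. -/
def diagonalOrbit (S : StarSubalgebra ℂ (H →L[ℂ] H)) (η : PiLp 2 (fun _ : ι => H)) :
    Submodule ℂ (PiLp 2 (fun _ : ι => H)) :=
  Submodule.topologicalClosure
    { carrier := {y | ∃ a ∈ S, diagonal ι a η = y}
      add_mem' := by
        rintro _ _ ⟨a, ha, rfl⟩ ⟨b, hb, rfl⟩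
        exact ⟨a + b, add_mem ha hb, by ext i; simp⟩
      zero_mem' := ⟨0, zero_mem S, by ext i; simp⟩
      smul_mem' := by
        rintro c _ ⟨a, ha, rfl⟩
        exact ⟨c • a, SMulMemClass.smul_mem c ha, by ext i; simp⟩ }

theorem mem_diagonalOrbit_iff {S : StarSubalgebra ℂ (H →L[ℂ] H)}
    {η x : PiLp 2 (fun _ : ι => H)} :
    x ∈ diagonalOrbit S η ↔ ∀ ε > 0, ∃ a ∈ S, ‖diagonal ι a η - x‖ < ε := by
  change x ∈ closure {y | ∃ a ∈ S, diagonal ι a η = y} ↔ _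
  rw [Metric.mem_closure_iff]
  simp [dist_comm x, dist_eq_norm]

theorem diagonal_mem_diagonalOrbit {S : StarSubalgebra ℂ (H →L[ℂ] H)}
    {η x : PiLp 2 (fun _ : ι => H)} {a : H →L[ℂ] H} (ha : a ∈ S) (hx : x ∈ diagonalOrbit S η) :
    diagonal ι a x ∈ diagonalOrbit S η := by
  refine map_mem_closure (diagonal ι a).continuous hx ?_
  rintro _ ⟨b, hb, rfl⟩
  exact ⟨a * b, mul_mem ha hb, by ext i; simp⟩

/-- The closed orbit is invariant under `a` and under `star a`, so its orthogonal projection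
commutes with `a`. -/
theorem starProjection_diagonal {S : StarSubalgebra ℂ (H →L[ℂ] H)}
    {η : PiLp 2 (fun _ : ι => H)} [(diagonalOrbit S η).HasOrthogonalProjection]
    {a : H →L[ℂ] H} (ha : a ∈ S) (x : PiLp 2 (fun _ : ι => H)) :
    (diagonalOrbit S η).starProjection (diagonal ι a x) =
      diagonal ι a ((diagonalOrbit S η).starProjection x) := by
  refine Submodule.eq_starProjection_of_mem_of_inner_eq_zero
    (diagonal_mem_diagonalOrbit ha (Submodule.starProjection_apply_mem _ x)) fun w hw => ?_
  rw [← map_sub, ← inner_conj_symm, ← inner_diagonal_left, inner_conj_symm]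
  exact Submodule.starProjection_inner_eq_zero x _ (diagonal_mem_diagonalOrbit (star_mem ha) hw)

/-- Each matrix entry of `P` commutes with `S`, so `hQ` applies entry by entry. -/
theorem commute_diagonal_of_forall_commute {S : StarSubalgebra ℂ (H →L[ℂ] H)} {Q : H →L[ℂ] H}
    (hQ : ∀ T : H →L[ℂ] H, (∀ a ∈ S, a * T = T * a) → T * Q = Q * T)
    {P : PiLp 2 (fun _ : ι => H) →L[ℂ] PiLp 2 (fun _ : ι => H)}
    (hP : ∀ a ∈ S, ∀ x, P (diagonal ι a x) = diagonal ι a (P x)) (x : PiLp 2 (fun _ : ι => H)) :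
    P (diagonal ι Q x) = diagonal ι Q (P x) := by
  classical
  let T (i j : ι) : H →L[ℂ] H :=
    (PiLp.proj 2 (fun _ : ι => H) i : _ →L[ℂ] H).comp (P.comp
      (((PiLp.continuousLinearEquiv 2 ℂ (fun _ : ι => H)).symm.toContinuousLinearMap).comp
        (ContinuousLinearMap.single ℂ (fun _ : ι => H) j)))
  have hT (i j : ι) (y : H) : T i j y = P (WithLp.toLp 2 (Pi.single j y)) i := rfl
  have hd (a : H →L[ℂ] H) (j : ι) (y : H) : (WithLp.toLp 2 (Pi.single j (a y)) :
      PiLp 2 (fun _ : ι => H)) = diagonal ι a (WithLp.toLp 2 (Pi.single j y)) := by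
    ext i
    by_cases h : i = j
    · subst h; simp
    · simp [h]
  have hTQ (i j : ι) : T i j * Q = Q * T i j := by
    refine hQ _ fun a ha => ?_
    ext y
    simp only [mul_apply_eq_comp, hT, hd, hP a ha, diagonal_apply]
  have hx (x : PiLp 2 (fun _ : ι => H)) (i : ι) : P x i = ∑ j, T i j (x j) := by
    have h1 : x = ∑ j, (WithLp.toLp 2 (Pi.single j (x j)) : PiLp 2 (fun _ : ι => H)) := by
      ext i
      simp [Finset.sum_pi_single]
    conv_lhs => rw [h1, map_sum]
    simp [hT]
  ext i
  rw [diagonal_apply, hx, hx, map_sum]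
  refine Finset.sum_congr rfl fun j _ => ?_
  exact congrArg (fun S : H →L[ℂ] H => S (x j)) (hTQ i j)

/-- The density part of the double commutant theorem: an element of the double commutant of a
unital *-algebra of operators is approximated by the algebra on finitely many vectors. -/
theorem exists_mem_norm_apply_sub_lt {S : StarSubalgebra ℂ (H →L[ℂ] H)} {Q : H →L[ℂ] H}
    (hQ : ∀ T : H →L[ℂ] H, (∀ a ∈ S, a * T = T * a) → T * Q = Q * T)
    (η : ι → H) {ε : ℝ} (hε : 0 < ε) : ∃ a ∈ S, ∀ i, ‖a (η i) - Q (η i)‖ < ε := by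
  let η' : PiLp 2 (fun _ : ι => H) := WithLp.toLp 2 η
  have : CompleteSpace (diagonalOrbit S η') :=
    (Submodule.isClosed_topologicalClosure _).completeSpace_coe
  have h1 : η' ∈ diagonalOrbit S η' :=
    mem_diagonalOrbit_iff.mpr fun ε hε => ⟨1, one_mem S, by
      have : diagonal ι (1 : H →L[ℂ] H) η' = η' := rfl
      simpa [this]⟩
  have h2 := commute_diagonal_of_forall_commute hQ
    (P := (diagonalOrbit S η').starProjection) (fun a ha => starProjection_diagonal ha) η'
  rw [Submodule.starProjection_eq_self_iff.mpr h1] at h2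
  obtain ⟨a, ha, h⟩ := mem_diagonalOrbit_iff.mp (Submodule.starProjection_eq_self_iff.mp h2) ε hε
  exact ⟨a, ha, fun i => (PiLp.norm_apply_le (diagonal ι a η' - diagonal ι Q η') i).trans_lt h⟩

end Density

/-! ### Bounded approximation of projections by commutative algebras -/

section Clamp

variable {H : Type v} [NormedAddCommGroup H] [InnerProductSpace ℂ H] [CompleteSpace H]

/-- The retraction of the real line onto the unit interval. -/
def clamp (x : ℝ) : ℝ := max 0 (min 1 x)

theorem continuous_clamp : Continuous clamp := by unfold clamp; fun_prop

theorem clamp_nonneg (x : ℝ) : 0 ≤ clamp x := le_max_left _ _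

theorem clamp_le_one (x : ℝ) : clamp x ≤ 1 := max_le zero_le_one (min_le_left _ _)

theorem clamp_sq_le (x : ℝ) : clamp x ^ 2 ≤ x ^ 2 := by
  unfold clamp
  rcases le_total x 0 with h | h
  · rw [min_eq_right (by linarith), max_eq_left h]; nlinarith
  · rcases le_total x 1 with h1 | h1
    · rw [min_eq_right h1, max_eq_right h]
    · rw [min_eq_left h1, max_eq_right zero_le_one]; nlinarith

theorem one_sub_clamp_sq_le (x : ℝ) : (1 - clamp x) ^ 2 ≤ (1 - x) ^ 2 := by
  unfold clamp
  rcases le_total x 0 with h | h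
  · rw [min_eq_right (by linarith), max_eq_left h]; nlinarith
  · rcases le_total x 1 with h1 | h1
    · rw [min_eq_right h1, max_eq_right h]
    · rw [min_eq_left h1, max_eq_right zero_le_one]; nlinarith

/-- `‖h(a) v‖² = ⟪h²(a) v, v⟫` and the functional calculus is monotone. If `a` is not self-adjoint,
`cfc` takes its default value `0` on both sides. -/
theorem norm_cfc_apply_le (a : H →L[ℂ] H) {f g : ℝ → ℝ}
    (hf : Continuous f) (hg : Continuous g) (hfg : ∀ x, f x ^ 2 ≤ g x ^ 2) (v : H) :
    ‖cfc f a v‖ ≤ ‖cfc g a v‖ := by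
  have key (h : ℝ → ℝ) (hh : Continuous h) :
      ‖cfc h a v‖ ^ 2 = RCLike.re ⟪cfc (fun x => h x ^ 2) a v, v⟫_ℂ := by
    have h1 : cfc (fun x => h x ^ 2) a = star (cfc h a) * cfc h a := by
      rw [(cfc_predicate h a : IsSelfAdjoint _).star_eq, ← cfc_mul ..]
      simp only [sq]
    rw [h1, mul_apply_eq_comp, ContinuousLinearMap.star_eq_adjoint,
      ContinuousLinearMap.adjoint_inner_left, inner_self_eq_norm_sq]
  have hle : cfc (fun x => f x ^ 2) a ≤ cfc (fun x => g x ^ 2) a :=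
    cfc_mono (fun x _ => hfg x) (by fun_prop) (by fun_prop)
  have h2 := (ContinuousLinearMap.le_def _ _).mp hle
  have h3 := h2.re_inner_nonneg_left v
  refine abs_le_of_sq_le_sq' ?_ (norm_nonneg _) |>.2
  rw [key f hf, key g hg]
  simp only [_root_.sub_apply, inner_sub_left, map_sub] at h3
  linarith

/-- Clamping a self-adjoint operator to the unit interval does not increase its distance to a
commuting projection. -/
theorem norm_cfc_clamp_sub_apply_le {a Q : H →L[ℂ] H} (ha : IsSelfAdjoint a)
    (hQ : IsStarProjection Q) (hc : Commute a Q) (v : H) :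
    ‖(cfc clamp a - Q) v‖ ≤ ‖(a - Q) v‖ := by
  have hb : Commute (cfc clamp a) Q := hc.cfc_real clamp
  -- The error splits orthogonally along `Q`: on its range `b` should be near `1`, on the complement
  -- near `0`. Clamping improves both.
  have key (b : H →L[ℂ] H) (hb : Commute b Q) :
      ‖(b - Q) v‖ ^ 2 = ‖(1 - b) (Q v)‖ ^ 2 + ‖b ((1 - Q) v)‖ ^ 2 := by
    have h1 : (b - Q) v = b ((1 - Q) v) - (1 - b) (Q v) := by simp
    have h2 : b * (1 - Q) = (1 - Q) * b := by rw [mul_sub, sub_mul, hb.eq]; simp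
    have h3 : (1 - b) * Q = Q * (1 - b) := by rw [mul_sub, sub_mul, hb.eq]; simp
    have h2' : b ((1 - Q) v) = (1 - Q) (b v) := congrArg (fun S : H →L[ℂ] H => S v) h2
    have h3' : (1 - b) (Q v) = Q ((1 - b) v) := congrArg (fun S : H →L[ℂ] H => S v) h3
    have h4 : ⟪b ((1 - Q) v), (1 - b) (Q v)⟫_ℂ = 0 := by
      rw [h2', h3', ← ContinuousLinearMap.adjoint_inner_left, ← ContinuousLinearMap.star_eq_adjoint,
        hQ.isSelfAdjoint.star_eq, ← mul_apply_eq_comp, hQ.mul_one_sub_self]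
      simp
    rw [h1, norm_sub_sq (𝕜 := ℂ), h4]
    simp; ring
  refine abs_le_of_sq_le_sq' ?_ (norm_nonneg _) |>.2
  rw [key _ hb, key _ hc]
  have e1 (w : H) : ‖(1 - cfc clamp a) w‖ ≤ ‖(1 - a) w‖ := by
    have h1 : 1 - cfc clamp a = cfc (fun x => 1 - clamp x) a := by
      rw [cfc_sub _ _ _ (by fun_prop) continuous_clamp.continuousOn, cfc_const_one ℝ a]
    have h2 : 1 - a = cfc (fun x : ℝ => 1 - x) a := by
      rw [cfc_sub .., cfc_const_one ℝ a, cfc_id' ℝ a]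
    rw [h1, h2]
    exact norm_cfc_apply_le a (continuous_const.sub continuous_clamp) (by fun_prop)
      one_sub_clamp_sq_le w
  have e2 (w : H) : ‖cfc clamp a w‖ ≤ ‖a w‖ := by
    have := norm_cfc_apply_le a continuous_clamp continuous_id clamp_sq_le w
    rwa [cfc_id ℝ a] at this
  gcongr
  · exact e1 _
  · exact e2 _

/-- Commutativity makes `a - Q` normal, so its adjoint is equally small on each vector, and the real
part of `a` approximates as well as `a`. -/
theorem exists_isSelfAdjoint_mem_norm_sub_apply_lt {ι : Type*} [Fintype ι]
    {S : StarSubalgebra ℂ (H →L[ℂ] H)} (hS : ∀ a ∈ S, ∀ b ∈ S, a * b = b * a) {Q : H →L[ℂ] H}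
    (hQ : ∀ T : H →L[ℂ] H, (∀ a ∈ S, a * T = T * a) → T * Q = Q * T) (hQs : IsSelfAdjoint Q)
    (η : ι → H) {ε : ℝ} (hε : 0 < ε) :
    ∃ a ∈ S, IsSelfAdjoint a ∧ ∀ i, ‖(a - Q) (η i)‖ < ε := by
  obtain ⟨a, ha, h⟩ := exists_mem_norm_apply_sub_lt hQ η hε
  refine ⟨(1 / 2 : ℂ) • (a + star a), SMulMemClass.smul_mem _ (add_mem ha (star_mem ha)), ?_,
    fun i => ?_⟩
  · simp [isSelfAdjoint_iff, add_comm]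
  · have hn : IsStarNormal (a - Q) := by
      have h1 : a * Q = Q * a := hQ a fun b hb => hS b hb a ha
      have h2 : star a * Q = Q * star a := hQ _ fun b hb => hS b hb _ (star_mem ha)
      constructor
      rw [star_sub, hQs.star_eq]
      change (star a - Q) * (a - Q) = (a - Q) * (star a - Q)
      simp only [sub_mul, mul_sub, h1, h2, hS _ (star_mem ha) a ha]
      abel
    have h3 : ‖star (a - Q) (η i)‖ = ‖(a - Q) (η i)‖ :=
      (ContinuousLinearMap.isStarNormal_iff_norm_eq_adjoint.mp hn (η i)).symm
    have h4 : (1 / 2 : ℂ) • (a + star a) - Q = (1 / 2 : ℂ) • ((a - Q) + star (a - Q)) := by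
      rw [star_sub, hQs.star_eq]; module
    have h5 : ‖(a - Q) (η i)‖ < ε := h i
    rw [h4, _root_.smul_apply, norm_smul, _root_.add_apply]
    have h6 := norm_add_le ((a - Q) (η i)) (star (a - Q) (η i))
    rw [h3] at h6
    rw [show ‖(1 / 2 : ℂ)‖ = 1 / 2 by norm_num]
    linarith

/-- A projection in the double commutant of a commutative unital *-algebra is approximated on
finitely many vectors by elements of the algebra which are almost contained in the operator
interval `[0, 1]`. -/
theorem exists_mem_approx_of_isStarProjection {ι : Type*} [Fintype ι]
    {S : StarSubalgebra ℂ (H →L[ℂ] H)} (hS : ∀ a ∈ S, ∀ b ∈ S, a * b = b * a) {Q : H →L[ℂ] H}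
    (hQ : ∀ T : H →L[ℂ] H, (∀ a ∈ S, a * T = T * a) → T * Q = Q * T) (hQp : IsStarProjection Q)
    (η : ι → H) {ε : ℝ} (hε : 0 < ε) :
    ∃ a ∈ S, 0 ≤ a + algebraMap ℝ _ ε ∧ a ≤ algebraMap ℝ _ (1 + ε) ∧
      ∀ i, ‖(a - Q) (η i)‖ ≤ ε * (1 + ‖η i‖) := by
  obtain ⟨a, ha, has, h⟩ := exists_isSelfAdjoint_mem_norm_sub_apply_lt hS hQ hQp.isSelfAdjoint η hε
  -- `S` need not be norm closed, so `clamp a` is replaced by a polynomial in `a`; this costs the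
  -- margin `ε` around `[0, 1]`. The factor `‖1‖` covers the trivial space `H`.
  obtain ⟨p, hp⟩ := exists_polynomial_near_of_continuousOn (-(‖a‖ * ‖(1 : H →L[ℂ] H)‖))
    (‖a‖ * ‖(1 : H →L[ℂ] H)‖) clamp continuous_clamp.continuousOn ε hε
  have hspec {x : ℝ} (hx : x ∈ spectrum ℝ a) : |p.eval x - clamp x| < ε :=
    hp x (abs_le.mp (spectrum.norm_le_norm_mul_of_mem hx))
  have hmem : Polynomial.aeval a p ∈ S :=
    Algebra.adjoin_le (S := S.toSubalgebra.restrictScalars ℝ) (Set.singleton_subset_iff.mpr ha)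
      (Polynomial.aeval_mem_adjoin_singleton ℝ a)
  have hcfc : Polynomial.aeval a p = cfc (fun x => p.eval x) a := (cfc_polynomial p a).symm
  refine ⟨Polynomial.aeval a p, hmem, ?_, ?_, fun i => ?_⟩
  · rw [hcfc, ← cfc_const ε a, ← cfc_add ..]
    refine cfc_nonneg fun x hx => ?_
    linarith [abs_lt.mp (hspec hx), clamp_nonneg x]
  · rw [hcfc]
    refine cfc_le_algebraMap _ _ _ fun x hx => ?_
    linarith [abs_lt.mp (hspec hx), clamp_le_one x]
  · have h1 : ‖Polynomial.aeval a p - cfc clamp a‖ ≤ ε := by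
      rw [hcfc, ← cfc_sub _ _ _ (by fun_prop) continuous_clamp.continuousOn]
      exact norm_cfc_le hε.le fun x hx => (hspec hx).le
    have h2 : (Polynomial.aeval a p - Q) (η i) =
        (Polynomial.aeval a p - cfc clamp a) (η i) + (cfc clamp a - Q) (η i) := by simp
    have hc : Commute a Q := hQ a fun b hb => hS b hb a ha
    rw [h2]
    calc _ ≤ _ := norm_add_le _ _
      _ ≤ ε * ‖η i‖ + ε := add_le_add (ContinuousLinearMap.le_of_opNorm_le _ h1 _)
          ((norm_cfc_clamp_sub_apply_le has hQp hc _).trans (h i).le)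
      _ = _ := by ring

end Clamp

/-! ### Normal states -/

section NormalState

variable {H : Type v} [NormedAddCommGroup H] [InnerProductSpace ℂ H] [CompleteSpace H]
variable {M : VonNeumannAlgebra H} {Φ : M.toStarSubalgebra →ₗ[ℂ] ℂ}

theorem mem_of_forall_commutant_commute {T : H →L[ℂ] H}
    (h : ∀ S ∈ M.commutant, S * T = T * S) : T ∈ M := by
  rw [← M.commutant_commutant]
  exact VonNeumannAlgebra.mem_commutant_iff.mpr h

theorem commute_of_mem_commutant {S T : H →L[ℂ] H} (hS : S ∈ M.commutant) (hT : T ∈ M) :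
    T * S = S * T :=
  VonNeumannAlgebra.mem_commutant_iff.mp hS T hT

/-- A normal state vanishes on the elements whose absolute square it annihilates. -/
theorem IsNormalState.apply_eq_zero (hΦ : IsNormalState M Φ) {X : M.toStarSubalgebra}
    (hX : Φ (star X * X) = 0) : Φ X = 0 := by
  -- Expansion of `Φ(|X + c|²) ≥ 0` with vanishing quadratic term in `X`: the part linear in `c`
  -- must vanish. The order on `ℂ` also encodes reality, which at `c = 1` and `c = i` shows that
  -- `Φ(X*)` is the conjugate of `Φ(X)`.
  have h (c : ℂ) : 0 ≤ c * Φ (star X) + star c * Φ X + star c * c := by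
    have h1 := hΦ.nonneg (X + c • 1)
    have h2 : star (X + c • 1) * (X + c • 1) =
        star X * X + c • star X + star c • X + (star c * c) • 1 := by
      simp only [star_add, star_smul, star_one, add_mul, mul_add, smul_mul_assoc, one_mul,
        mul_smul_comm, mul_one, smul_smul, smul_add]
      rw [mul_comm c]
      abel
    rw [h2] at h1
    simpa [hX, hΦ.map_one] using h1
  have hre (t : ℝ) : 0 ≤ t * ((Φ (star X)).re + (Φ X).re) + t * t := by
    have := (Complex.le_def.mp (h t)).1
    simp at this; linarith
  have him (t : ℝ) : 0 ≤ t * ((Φ X).im - (Φ (star X)).im) + t * t := by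
    have := (Complex.le_def.mp (h (t * Complex.I))).1
    simp at this; linarith
  have h1 := (Complex.le_def.mp (h 1)).2
  have h2 := (Complex.le_def.mp (h Complex.I)).2
  simp at h1 h2
  have hz {a : ℝ} (ha : ∀ t : ℝ, 0 ≤ t * a + t * t) : a = 0 := by
    have := ha (-a / 2); nlinarith
  have h3 := hz hre
  have h4 := hz him
  apply Complex.ext
  · simp; linarith
  · simp; linarith

/-- The square root of `X` commutes with the commutant of `M`, so it lies in `M` and `X` is a square
there. -/
theorem IsNormalState.apply_nonneg (hΦ : IsNormalState M Φ) {X : M.toStarSubalgebra}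
    (hX : 0 ≤ (X : H →L[ℂ] H)) : 0 ≤ Φ X := by
  have hsa : IsSelfAdjoint (X : H →L[ℂ] H) := .of_nonneg hX
  have hmem : cfc Real.sqrt (X : H →L[ℂ] H) ∈ M := mem_of_forall_commutant_commute fun S hS =>
    (Commute.cfc_real (show Commute (X : H →L[ℂ] H) S from
      commute_of_mem_commutant hS X.2) Real.sqrt).eq.symm
  have h1 : X = star (⟨_, hmem⟩ : M.toStarSubalgebra) * ⟨_, hmem⟩ := by
    apply Subtype.ext
    change (X : H →L[ℂ] H) = star (cfc Real.sqrt (X : H →L[ℂ] H)) * cfc Real.sqrt (X : H →L[ℂ] H)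
    rw [(cfc_predicate Real.sqrt (X : H →L[ℂ] H) : IsSelfAdjoint _).star_eq, ← cfc_mul ..]
    conv_lhs => rw [← cfc_id' ℝ (X : H →L[ℂ] H)]
    exact cfc_congr fun x hx => (Real.mul_self_sqrt (spectrum_nonneg_of_nonneg hX hx)).symm
  rw [h1]
  exact hΦ.nonneg _

/-- On norm-bounded sets a normal state is controlled by the values on finitely many vectors. -/
theorem IsNormalState.exists_finset_norm_apply_le (hΦ : IsNormalState M Φ) (C : ℝ) {δ : ℝ}
    (hδ : 0 < δ) : ∃ V : Finset H, ∃ ε > 0, ∀ X : M.toStarSubalgebra, ‖(X : H →L[ℂ] H)‖ ≤ C →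
      (∀ v ∈ V, ‖(X : H →L[ℂ] H) v‖ ≤ ε * (1 + ‖v‖)) → ‖Φ X‖ ≤ δ := by
  classical
  obtain ⟨ξ, η, hξ, hη, hs⟩ := hΦ.normal
  have hsum : Summable fun k => ‖ξ k‖ * ‖η k‖ :=
    Summable.of_nonneg_of_le (fun k => by positivity)
      (fun k => by nlinarith [sq_nonneg (‖ξ k‖ - ‖η k‖), sq_nonneg ‖ξ k‖, sq_nonneg ‖η k‖])
      (hξ.add hη)
  -- The norm bound `C` controls the tail of the series for `Φ X`; the finitely many remaining terms
  -- are controlled on the vectors `η k`.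
  have htail := tendsto_tsum_compl_atTop_zero fun k => |C| * (‖ξ k‖ * ‖η k‖)
  obtain ⟨F, hF⟩ := (htail.eventually (gt_mem_nhds (half_pos hδ))).exists
  let D := ∑ k ∈ F, ‖ξ k‖ * (1 + ‖η k‖)
  have hD : 0 ≤ D := Finset.sum_nonneg fun k _ => by positivity
  refine ⟨F.image η, δ / 2 / (1 + D), by positivity, fun X hX hV => ?_⟩
  have hle (k : ℕ) : ‖ξ k‖ * ‖(X : H →L[ℂ] H) (η k)‖ ≤ |C| * (‖ξ k‖ * ‖η k‖) := by
    have := (X : H →L[ℂ] H).le_of_opNorm_le (hX.trans (le_abs_self C)) (η k)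
    nlinarith [norm_nonneg (ξ k)]
  have hsumX : Summable fun k => ‖ξ k‖ * ‖(X : H →L[ℂ] H) (η k)‖ :=
    Summable.of_nonneg_of_le (fun k => by positivity) hle (hsum.mul_left _)
  calc ‖Φ X‖ = ‖∑' k, ⟪ξ k, (X : H →L[ℂ] H) (η k)⟫_ℂ‖ := by rw [(hs X).tsum_eq]
    _ ≤ ∑' k, ‖ξ k‖ * ‖(X : H →L[ℂ] H) (η k)‖ :=
      tsum_of_norm_bounded hsumX.hasSum fun k => norm_inner_le_norm _ _
    _ = ∑ k ∈ F, ‖ξ k‖ * ‖(X : H →L[ℂ] H) (η k)‖ +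
        ∑' k : {k // k ∉ F}, ‖ξ k‖ * ‖(X : H →L[ℂ] H) (η k)‖ :=
      (hsumX.sum_add_tsum_subtype_compl F).symm
    _ ≤ ∑ k ∈ F, δ / 2 / (1 + D) * (‖ξ k‖ * (1 + ‖η k‖)) + δ / 2 := by
      refine add_le_add (Finset.sum_le_sum fun k hk => ?_) (le_trans ?_ hF.le)
      · have := hV (η k) (Finset.mem_image_of_mem η hk)
        calc _ ≤ ‖ξ k‖ * (δ / 2 / (1 + D) * (1 + ‖η k‖)) := by gcongr
          _ = _ := by ring
      · exact Summable.tsum_le_tsum (fun k => hle k) (hsumX.subtype _)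
          ((hsum.mul_left _).subtype _)
    _ = δ / 2 * (D / (1 + D)) + δ / 2 := by rw [← Finset.mul_sum]; ring
    _ ≤ δ / 2 * 1 + δ / 2 := by
      gcongr
      rw [div_le_one (by positivity)]; linarith
    _ = δ := by ring

end NormalState

/-! ### Approximation of the observations -/

section Observations

variable {H : Type v} [NormedAddCommGroup H] [InnerProductSpace ℂ H] [CompleteSpace H]

/-- The set of admissible `T` is closed under adjoints, so commutation with `T` alone suffices. -/
theorem mem_generatedBy_iff {S : Set (H →ₗ.[ℂ] H)} {B : H →L[ℂ] H} :
    B ∈ generatedBy S ↔ ∀ T : H →L[ℂ] H,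
      (∀ Y ∈ S, CommutesWith T Y ∧ CommutesWith (star T) Y) → T * B = B * T := by
  change B ∈ StarSubalgebra.centralizer ℂ _ ↔ _
  rw [StarSubalgebra.mem_centralizer_iff]
  constructor
  · exact fun h T hT => (h T hT).1
  · refine fun h T hT => ⟨h T hT, h (star T) fun Y hY => ⟨(hT Y hY).2, ?_⟩⟩
    rw [star_star]
    exact (hT Y hY).1

namespace FilteringModel

variable {A : Type u} [CStarAlgebra A] [PartialOrder A] [StarOrderedRing A] {n : ℕ}
  (𝓕 : FilteringModel A H n)

/-- The real and imaginary parts of the resolvents of the observations at positive times. -/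
def obsResolvents : Set (H →L[ℂ] H) :=
  {B | ∃ t : ℝ≥0, 0 < t ∧ ∃ k, ∃ f ∈ ({resolventRe, resolventIm} : Set (ℝ →ᵇ ℝ)),
    B = applyFun f (𝓕.Y t k)}

/-- The unital *-algebra generated by the resolvents of the observations. -/
def obsAlgebra : StarSubalgebra ℂ (H →L[ℂ] H) := StarAlgebra.adjoin ℂ 𝓕.obsResolvents

variable {𝓕}

theorem applyFun_mem_of_resolvent_mem {t : ℝ≥0} {k : Fin n} {N : VonNeumannAlgebra H}
    (hN : ∀ R, IsResolvent (𝓕.Y t k) R → R ∈ N) {f : ℝ →ᵇ ℝ}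
    (hf : f ∈ ({resolventRe, resolventIm} : Set (ℝ →ᵇ ℝ))) : applyFun f (𝓕.Y t k) ∈ N := by
  have hY := 𝓕.Y_selfAdjoint t k
  obtain ⟨R, hR⟩ := exists_isResolvent hY
  have hRN : R ∈ N.toStarSubalgebra := hN R hR
  rcases hf with rfl | rfl
  · rw [hR.applyFun_resolventRe hY]
    exact SMulMemClass.smul_mem (S := StarSubalgebra ℂ (H →L[ℂ] H)) _ (add_mem (star_mem hRN) hRN)
  · rw [hR.applyFun_resolventIm hY]
    exact mul_mem (star_mem hRN) hRN

theorem isSelfAdjoint_of_mem_obsResolvents {B : H →L[ℂ] H} (hB : B ∈ 𝓕.obsResolvents) :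
    IsSelfAdjoint B := by
  obtain ⟨t, -, k, f, hf, rfl⟩ := hB
  have hY := 𝓕.Y_selfAdjoint t k
  obtain ⟨R, hR⟩ := exists_isResolvent hY
  rcases hf with rfl | rfl
  · rw [hR.applyFun_resolventRe hY]
    simp [isSelfAdjoint_iff, add_comm]
  · rw [hR.applyFun_resolventIm hY]
    exact .star_mul_self R

theorem obsResolvents_subset : 𝓕.obsResolvents ⊆ (𝓕.M : Set (H →L[ℂ] H)) := by
  rintro _ ⟨t, -, k, f, hf, rfl⟩
  refine 𝓕.Mt_le t (applyFun_mem_of_resolvent_mem (fun R hR => ?_) hf)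
  exact mem_of_forall_commutant_commute fun T hT =>
    hR.isResolventAt.commutesWith_iff.mp (𝓕.Y_affiliated t k T hT)

theorem obsAlgebra_le : 𝓕.obsAlgebra ≤ 𝓕.M.toStarSubalgebra :=
  StarAlgebra.adjoin_le obsResolvents_subset

theorem applyFun_mem_obsUpTo {s t : ℝ≥0} (hst : s ≤ t) {k : Fin n} {f : ℝ →ᵇ ℝ}
    (hf : f ∈ ({resolventRe, resolventIm} : Set (ℝ →ᵇ ℝ))) :
    applyFun f (𝓕.Y s k) ∈ 𝓕.obsUpTo t := by
  refine applyFun_mem_of_resolvent_mem (fun R hR => ?_) hf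
  rw [obsUpTo, mem_generatedBy_iff]
  exact fun T hT => hR.isResolventAt.commutesWith_iff.mp (hT _ ⟨s, hst, k, rfl⟩).1

theorem obsAlgebra_commute (a : H →L[ℂ] H) (ha : a ∈ 𝓕.obsAlgebra) (b : H →L[ℂ] H)
    (hb : b ∈ 𝓕.obsAlgebra) : a * b = b * a := by
  have hcomm : ∀ a ∈ 𝓕.obsResolvents, ∀ b ∈ 𝓕.obsResolvents, a * b = b * a := by
    rintro _ ⟨s, -, k, f, hf, rfl⟩ _ ⟨t, -, l, g, hg, rfl⟩
    exact 𝓕.selfNondemolition (max s t) _ (applyFun_mem_obsUpTo (le_max_left s t) hf) _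
      (applyFun_mem_obsUpTo (le_max_right s t) hg)
  have := StarAlgebra.isMulCommutative_adjoin ℂ hcomm fun a ha b hb => by
    rw [(isSelfAdjoint_of_mem_obsResolvents hb).star_eq]; exact hcomm a ha b hb
  exact congrArg Subtype.val (this.is_comm.comm ⟨a, ha⟩ ⟨b, hb⟩)

/-- Omitting time `0` from the generators loses nothing, because `Y 0 k = 0` is everywhere defined
and commutes with every bounded operator. -/
theorem commutesWith_of_commute_obsAlgebra {T : H →L[ℂ] H}
    (hT : ∀ a ∈ 𝓕.obsAlgebra, a * T = T * a) (t : ℝ≥0) (k : Fin n) : CommutesWith T (𝓕.Y t k) := by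
  rcases eq_or_ne t 0 with rfl | ht
  · rw [𝓕.Y_zero]
    exact fun ψ => ⟨trivial, by simp⟩
  · have hY := 𝓕.Y_selfAdjoint t k
    obtain ⟨R, hR⟩ := exists_isResolvent hY
    refine hR.isResolventAt.commutesWith_iff.mpr (hT R ?_).symm
    have hmem {f : ℝ →ᵇ ℝ} (hf : f ∈ ({resolventRe, resolventIm} : Set (ℝ →ᵇ ℝ))) :
        applyFun f (𝓕.Y t k) ∈ 𝓕.obsAlgebra :=
      StarAlgebra.subset_adjoin _ _ ⟨t, pos_iff_ne_zero.mpr ht, k, f, hf, rfl⟩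
    rw [hR.eq_applyFun hY]
    exact sub_mem (hmem (by simp)) (SMulMemClass.smul_mem _ (hmem (by simp)))

theorem commute_of_mem_obs {Q : H →L[ℂ] H} (hQ : Q ∈ 𝓕.obs) (T : H →L[ℂ] H)
    (hT : ∀ a ∈ 𝓕.obsAlgebra, a * T = T * a) : T * Q = Q * T := by
  have hT' : ∀ a ∈ 𝓕.obsAlgebra, a * star T = star T * a := fun a ha => by
    have := congrArg star (hT _ (star_mem ha))
    simpa using this.symm
  refine Set.mem_centralizer_iff.mp hQ T (Set.mem_centralizer_iff.mpr fun B hB => ?_)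
  obtain ⟨t, hB⟩ := Set.mem_iUnion.mp hB
  refine (mem_generatedBy_iff.mp hB T ?_).symm
  rintro _ ⟨s, -, k, rfl⟩
  exact ⟨commutesWith_of_commute_obsAlgebra hT s k, commutesWith_of_commute_obsAlgebra hT' s k⟩

/-- `Φ_ρ(X) = Φ_ρ(E(X)) = Φ_ρ(j_0 Z) = ρ(Z)`; indistinguishability gives the middle equality. -/
theorem apply_eq_of_indistinguishable {ρ : stateSpace A} {X : 𝓕.M.toStarSubalgebra} {Z : A}
    (h : Indistinguishable (𝓕.Φ ρ) (𝓕.E ρ 0 X) (𝓕.j 0 Z)) : 𝓕.Φ ρ X = ρ.1 Z := by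
  have h1 := (𝓕.Φ_normal ρ).apply_eq_zero h
  rwa [map_sub, sub_eq_zero, (𝓕.E_isCondExp ρ 0).expectation, 𝓕.initial] at h1

theorem exists_apply_prod_eq (l : List (H →L[ℂ] H)) (hl : ∀ B ∈ l, B ∈ 𝓕.obsResolvents) :
    ∃ Z : A, ∀ (ρ : stateSpace A) (X : 𝓕.M.toStarSubalgebra), (X : H →L[ℂ] H) = l.prod →
      𝓕.Φ ρ X = ρ.1 Z := by
  have h (i : Fin l.length) : ∃ t : ℝ≥0, 0 < t ∧ ∃ k, ∃ f : ℝ →ᵇ ℝ,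
      l.get i = applyFun f (𝓕.Y t k) := by
    obtain ⟨t, ht, k, f, -, h⟩ := hl _ (l.get_mem i)
    exact ⟨t, ht, k, f, h⟩
  choose t ht κ f hf using h
  obtain ⟨Z, hZ⟩ := 𝓕.feller l.length t κ f ht
  refine ⟨Z, fun ρ X hX => apply_eq_of_indistinguishable ((hZ ρ).1 X ?_)⟩
  rw [hX]
  simp_rw [← hf]
  rw [List.ofFn_get]

/-- Expectations of elements of the observation algebra are affine functions of the initial
state. -/
theorem exists_apply_eq {a : H →L[ℂ] H} (ha : a ∈ 𝓕.obsAlgebra) :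
    ∃ Z : A, ∀ (ρ : stateSpace A) (X : 𝓕.M.toStarSubalgebra), (X : H →L[ℂ] H) = a →
      𝓕.Φ ρ X = ρ.1 Z := by
  have hstar : star 𝓕.obsResolvents = 𝓕.obsResolvents := by
    ext B
    constructor
    · intro h
      have := (isSelfAdjoint_of_mem_obsResolvents (Set.mem_star.mp h)).star_eq
      rw [star_star] at this
      rw [this]; exact h
    · intro h
      rw [Set.mem_star, (isSelfAdjoint_of_mem_obsResolvents h).star_eq]; exact h
  have hspan : a ∈ Submodule.span ℂ (Submonoid.closure 𝓕.obsResolvents : Set (H →L[ℂ] H)) := by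
    have h1 : a ∈ Algebra.adjoin ℂ (𝓕.obsResolvents ∪ star 𝓕.obsResolvents) := ha
    rw [hstar, Set.union_self] at h1
    rw [← Algebra.adjoin_eq_span]
    exact h1
  -- `Φ ρ` is defined only on `M`, so the terms met in the span induction must be known to lie
  -- there.
  have hM : ∀ b ∈ Submodule.span ℂ (Submonoid.closure 𝓕.obsResolvents : Set (H →L[ℂ] H)),
      b ∈ 𝓕.M.toStarSubalgebra := by
    intro b hb
    rw [← Algebra.adjoin_eq_span] at hb
    exact Algebra.adjoin_le (S := 𝓕.M.toStarSubalgebra.toSubalgebra) obsResolvents_subset hb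
  clear ha
  induction hspan using Submodule.span_induction with
  | mem x hx =>
    obtain ⟨l, hl, rfl⟩ := Submonoid.exists_list_of_mem_closure hx
    exact exists_apply_prod_eq l hl
  | zero =>
    refine ⟨0, fun ρ X hX => ?_⟩
    obtain rfl : X = 0 := Subtype.ext hX
    simp
  | add x y hx hy ihx ihy =>
    obtain ⟨Z, hZ⟩ := ihx
    obtain ⟨Z', hZ'⟩ := ihy
    refine ⟨Z + Z', fun ρ X hX => ?_⟩
    obtain rfl : X = ⟨x, hM x hx⟩ + ⟨y, hM y hy⟩ := Subtype.ext hX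
    rw [map_add, hZ ρ _ rfl, hZ' ρ _ rfl, map_add]
  | smul c x hx ih =>
    obtain ⟨Z, hZ⟩ := ih
    refine ⟨c • Z, fun ρ X hX => ?_⟩
    obtain rfl : X = c • ⟨x, hM x hx⟩ := Subtype.ext hX
    rw [map_smul, hZ ρ _ rfl, map_smul]

end FilteringModel

end Observations

/-! ### Absolute continuity of the laws of the observations -/

/-- Convergence to zero in mean of a uniformly bounded sequence of nonnegative functions passes,
along a subsequence, to an absolutely continuous measure. -/
theorem exists_subseq_tendsto_integral_of_absolutelyContinuous {Ω : Type*} [MeasurableSpace Ω]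
    {μ ν : Measure Ω} [IsFiniteMeasure μ] [IsFiniteMeasure ν] (hμν : μ ≪ ν) {h : ℕ → Ω → ℝ}
    (hm : ∀ n, Measurable (h n)) {C : ℝ} (h0 : ∀ n ω, 0 ≤ h n ω) (hC : ∀ n ω, h n ω ≤ C)
    (hlim : Filter.Tendsto (fun n => ∫ ω, h n ω ∂ν) Filter.atTop (nhds 0)) :
    ∃ ns : ℕ → ℕ, StrictMono ns ∧
      Filter.Tendsto (fun i => ∫ ω, h (ns i) ω ∂μ) Filter.atTop (nhds 0) := by
  have hb (n : ℕ) (ω : Ω) : ‖h n ω‖ ≤ C := by rw [Real.norm_of_nonneg (h0 n ω)]; exact hC n ω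
  have hint (n : ℕ) : Integrable (h n) ν :=
    .of_bound (hm n).aestronglyMeasurable C (.of_forall (hb n))
  have hL1 : Filter.Tendsto (fun n => eLpNorm (h n - 0) 1 ν) Filter.atTop (nhds 0) := by
    have h1 (n : ℕ) : eLpNorm (h n - 0) 1 ν = ENNReal.ofReal (∫ ω, h n ω ∂ν) := by
      rw [sub_zero, eLpNorm_one_eq_lintegral_enorm,
        ofReal_integral_eq_lintegral_ofReal (hint n) (.of_forall (h0 n))]
      exact lintegral_congr fun ω => Real.enorm_of_nonneg (h0 n ω)
    simp_rw [h1]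
    have h2 := (ENNReal.continuous_ofReal.tendsto 0).comp hlim
    rwa [ENNReal.ofReal_zero] at h2
  -- Convergence in `L¹(ν)` gives convergence in measure, hence `ν`-a.e. along a subsequence.
  obtain ⟨ns, hns, hae⟩ := (tendstoInMeasure_of_tendsto_eLpNorm one_ne_zero
    (fun n => (hm n).aestronglyMeasurable) aestronglyMeasurable_zero hL1).exists_seq_tendsto_ae
  refine ⟨ns, hns, ?_⟩
  have := tendsto_integral_of_dominated_convergence (F := fun i => h (ns i)) (f := 0) (μ := μ)
    (fun _ => C) (fun i => (hm _).aestronglyMeasurable) (integrable_const C)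
    (fun i => .of_forall (hb _)) (hμν.ae_le hae)
  simpa using this

namespace FilteringModel

variable {H : Type v} [NormedAddCommGroup H] [InnerProductSpace ℂ H] [CompleteSpace H]
variable {A : Type u} [CStarAlgebra A] [PartialOrder A] [StarOrderedRing A] {n : ℕ}
  {𝓕 : FilteringModel A H n}

/-- The expectation of a projection generated by the observations is approximated, simultaneously
for two initial states, by affine functions of the initial state which are almost `[0, 1]`-valued
on all initial states. -/
theorem exists_approx_apply_obs (ρ₁ ρ₂ : stateSpace A) {Q : 𝓕.M.toStarSubalgebra}
    (hQ : (Q : H →L[ℂ] H) ∈ 𝓕.obs) (hQp : IsStarProjection Q) {δ : ℝ} (hδ : 0 < δ) :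
    ∃ Z : A, (∀ φ : stateSpace A, 0 ≤ φ.1 Z + (δ : ℂ) ∧ φ.1 Z ≤ 1 + (δ : ℂ)) ∧
      ‖ρ₁.1 Z - 𝓕.Φ ρ₁ Q‖ ≤ δ ∧ ‖ρ₂.1 Z - 𝓕.Φ ρ₂ Q‖ ≤ δ := by
  classical
  have hQp' : IsStarProjection (Q : H →L[ℂ] H) :=
    ⟨congrArg Subtype.val hQp.isIdempotentElem, congrArg Subtype.val hQp.isSelfAdjoint⟩
  -- The bound `5` is fixed before `ε`: with `ε ≤ 1`, the triangle inequality gives `‖a - Q‖ ≤ (1 +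
  -- 2ε) + ε + 1 ≤ 5`.
  obtain ⟨V₁, ε₁, hε₁, h₁⟩ := (𝓕.Φ_normal ρ₁).exists_finset_norm_apply_le 5 hδ
  obtain ⟨V₂, ε₂, hε₂, h₂⟩ := (𝓕.Φ_normal ρ₂).exists_finset_norm_apply_le 5 hδ
  let ε := min (min ε₁ ε₂) (min δ 1)
  have hε : 0 < ε := by simp only [ε, lt_min_iff]; exact ⟨⟨hε₁, hε₂⟩, hδ, one_pos⟩
  have hεε₁ : ε ≤ ε₁ := (min_le_left _ _).trans (min_le_left _ _)
  have hεε₂ : ε ≤ ε₂ := (min_le_left _ _).trans (min_le_right _ _)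
  have hεδ : ε ≤ δ := (min_le_right _ _).trans (min_le_left _ _)
  have hε1 : ε ≤ 1 := (min_le_right _ _).trans (min_le_right _ _)
  obtain ⟨a, ha, ha0, ha1, hav⟩ := exists_mem_approx_of_isStarProjection
    (obsAlgebra_commute (𝓕 := 𝓕)) (commute_of_mem_obs hQ) hQp'
    (fun v : {v // v ∈ V₁ ∪ V₂} => (v : H)) hε
  obtain ⟨Z, hZ⟩ := exists_apply_eq ha
  obtain ⟨X, hX⟩ : ∃ X : 𝓕.M.toStarSubalgebra, (X : H →L[ℂ] H) = a :=
    ⟨⟨a, obsAlgebra_le ha⟩, rfl⟩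
  have hone : ‖(1 : H →L[ℂ] H)‖ ≤ 1 := ContinuousLinearMap.norm_id_le
  have hnorm_algebraMap {r : ℝ} (hr : 0 ≤ r) : ‖algebraMap ℝ (H →L[ℂ] H) r‖ ≤ r := by
    rw [norm_algebraMap, Real.norm_of_nonneg hr]
    exact mul_le_of_le_one_right hr hone
  have hnorm : ‖((X - Q : 𝓕.M.toStarSubalgebra) : H →L[ℂ] H)‖ ≤ 5 := by
    have h1 : ‖a + algebraMap ℝ _ ε‖ ≤ 1 + ε + ε := by
      refine (CStarAlgebra.norm_le_iff_le_algebraMap _ (by positivity) ha0).mpr ?_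
      rw [map_add _ (1 + ε)]
      gcongr
    have h2 := hnorm_algebraMap hε.le
    have h3 : ‖(Q : H →L[ℂ] H)‖ ≤ 1 := hQp'.norm_le
    have h4 : ((X - Q : 𝓕.M.toStarSubalgebra) : H →L[ℂ] H) =
        (a + algebraMap ℝ _ ε) - algebraMap ℝ _ ε - Q := by
      change (X : H →L[ℂ] H) - (Q : H →L[ℂ] H) = _
      rw [hX]
      abel
    rw [h4]
    have h5 := norm_sub_le ((a + algebraMap ℝ _ ε) - algebraMap ℝ _ ε) (Q : H →L[ℂ] H)
    have h6 := norm_sub_le (a + algebraMap ℝ _ ε) (algebraMap ℝ _ ε)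
    linarith
  have hreal (r : ℝ) : ∃ W : 𝓕.M.toStarSubalgebra, (W : H →L[ℂ] H) = algebraMap ℝ _ r ∧
      ∀ φ, 𝓕.Φ φ W = r := by
    refine ⟨(r : ℂ) • 1, ?_, fun φ => ?_⟩
    · change (r : ℂ) • (1 : H →L[ℂ] H) = _
      rw [Algebra.algebraMap_eq_smul_one]
      ext v
      simp
    · rw [map_smul, (𝓕.Φ_normal φ).map_one, smul_eq_mul, mul_one]
  obtain ⟨W₀, hW₀, hΦW₀⟩ := hreal ε
  obtain ⟨W₁, hW₁, hΦW₁⟩ := hreal (1 + ε)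
  refine ⟨Z, fun φ => ⟨?_, ?_⟩, ?_, ?_⟩
  · have h0 : 0 ≤ ((X + W₀ : 𝓕.M.toStarSubalgebra) : H →L[ℂ] H) := by
      change 0 ≤ (X : H →L[ℂ] H) + (W₀ : H →L[ℂ] H)
      rwa [hX, hW₀]
    have h := (𝓕.Φ_normal φ).apply_nonneg h0
    rw [map_add, hZ φ X hX, hΦW₀] at h
    refine h.trans ?_
    gcongr
    exact_mod_cast hεδ
  · have h0 : 0 ≤ ((W₁ - X : 𝓕.M.toStarSubalgebra) : H →L[ℂ] H) := by
      change 0 ≤ (W₁ : H →L[ℂ] H) - (X : H →L[ℂ] H)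
      rwa [hX, hW₁, sub_nonneg]
    have h := (𝓕.Φ_normal φ).apply_nonneg h0
    rw [map_sub, hZ φ X hX, hΦW₁, sub_nonneg] at h
    refine h.trans ?_
    push_cast
    gcongr
    exact_mod_cast hεδ
  · rw [← hZ ρ₁ X hX, ← map_sub]
    refine h₁ _ hnorm fun v hv => ?_
    change ‖((X : H →L[ℂ] H) - (Q : H →L[ℂ] H)) v‖ ≤ _
    rw [hX]
    refine (hav ⟨v, Finset.mem_union_left _ hv⟩).trans ?_
    gcongr
  · rw [← hZ ρ₂ X hX, ← map_sub]
    refine h₂ _ hnorm fun v hv => ?_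
    change ‖((X : H →L[ℂ] H) - (Q : H →L[ℂ] H)) v‖ ≤ _
    rw [hX]
    refine (hav ⟨v, Finset.mem_union_right _ hv⟩).trans ?_
    gcongr

end FilteringModel

/-- The complex inequality `hZ` forces `φ(Z)` to be real, so the barycenter formula reduces to a
real integral. -/
theorem IsBarycenter.integral_re_add_eq {A : Type u} [CStarAlgebra A] {ρ : stateSpace A}
    {μ : Measure (stateSpace A)} [IsProbabilityMeasure μ] (h : IsBarycenter ρ μ) {Z : A} {δ : ℝ}
    (hZ : ∀ φ : stateSpace A, 0 ≤ φ.1 Z + (δ : ℂ))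
    (hint : Integrable (fun φ : stateSpace A => (φ.1 Z).re + δ) μ) :
    ∫ φ : stateSpace A, ((φ.1 Z).re + δ) ∂μ = (ρ.1 Z).re + δ := by
  have h1 (φ : stateSpace A) : φ.1 Z = (((φ.1 Z).re + δ : ℝ) : ℂ) - δ := by
    have h2 := (Complex.le_def.mp (hZ φ)).2
    apply Complex.ext
    · simp
    · simp at h2; simp [← h2]
  have h2 : ρ.1 Z = ((∫ φ : stateSpace A, ((φ.1 Z).re + δ) ∂μ : ℝ) : ℂ) - δ := by
    rw [h Z, integral_congr_ae (.of_forall h1), integral_sub hint.ofReal (integrable_const _),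
      integral_const, probReal_univ, one_smul, integral_complex_ofReal]
  rw [h2]
  simp

theorem FilteringModel.obsLawAbsolutelyContinuous
    {H : Type v} [NormedAddCommGroup H] [InnerProductSpace ℂ H] [CompleteSpace H]
    {A : Type u} [CStarAlgebra A] [PartialOrder A] [StarOrderedRing A] {n : ℕ}
    (𝓕 : FilteringModel A H n) {ρ₁ ρ₂ : stateSpace A} (h : StateAbsolutelyContinuous ρ₁ ρ₂) :
    𝓕.ObsLawAbsolutelyContinuous ρ₁ ρ₂ := by
  intro Q hQ hQp hQ₂
  obtain ⟨μ₁, μ₂, hμ₁, hμ₂, -, -, hb₁, hb₂, hμ⟩ := h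
  let δ (m : ℕ) : ℝ := 1 / ((m : ℝ) + 1)
  have hδ (m : ℕ) : 0 < δ m := Nat.one_div_pos_of_nat
  have hδ1 (m : ℕ) : δ m ≤ 1 := by
    rw [div_le_one (by positivity)]
    linarith [m.cast_nonneg (α := ℝ)]
  have hδ0 : Filter.Tendsto δ Filter.atTop (nhds 0) := tendsto_one_div_add_atTop_nhds_zero_nat
  choose Z hZ hZ₁ hZ₂ using fun m => exists_approx_apply_obs ρ₁ ρ₂ hQ hQp (hδ m)
  let g (m : ℕ) (φ : stateSpace A) : ℝ := (φ.1 (Z m)).re + δ m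
  have hg0 (m : ℕ) (φ : stateSpace A) : 0 ≤ g m φ := by
    simpa using (Complex.le_def.mp (hZ m φ).1).1
  have hg3 (m : ℕ) (φ : stateSpace A) : g m φ ≤ 3 := by
    have := (Complex.le_def.mp (hZ m φ).2).1
    simp at this
    linarith [hδ1 m]
  have hgm (m : ℕ) : Measurable (g m) := by
    have : Continuous fun φ : stateSpace A => φ.1 (Z m) :=
      (WeakDual.eval_continuous (Z m)).comp continuous_subtype_val
    exact ((Complex.continuous_re.comp this).add continuous_const).measurable
  have hgint (m : ℕ) (μ : Measure (stateSpace A)) [IsProbabilityMeasure μ] :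
      Integrable (g m) μ :=
    .of_bound (hgm m).aestronglyMeasurable 3
      (.of_forall fun φ => by rw [Real.norm_of_nonneg (hg0 m φ)]; exact hg3 m φ)
  -- Applied to both states: for `ρ₂` the limit is `0` by assumption, while for `ρ₁` it is compared
  -- with the limit `0` along the subsequence.
  have hlim {ρ : stateSpace A} {μ : Measure (stateSpace A)} [IsProbabilityMeasure μ]
      (hb : IsBarycenter ρ μ) (hZρ : ∀ m, ‖ρ.1 (Z m) - 𝓕.Φ ρ Q‖ ≤ δ m) :
      Filter.Tendsto (fun m => ∫ φ, g m φ ∂μ) Filter.atTop (nhds (𝓕.Φ ρ Q).re) := by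
    have h1 : Filter.Tendsto (fun m => ρ.1 (Z m)) Filter.atTop (nhds (𝓕.Φ ρ Q)) :=
      tendsto_iff_norm_sub_tendsto_zero.mpr (squeeze_zero (fun _ => norm_nonneg _) hZρ hδ0)
    have h2 := ((Complex.continuous_re.tendsto _).comp h1).add hδ0
    rw [add_zero] at h2
    exact h2.congr fun m => (hb.integral_re_add_eq (fun φ => (hZ m φ).1) (hgint m μ)).symm
  have hlim₂ := hlim hb₂ hZ₂
  rw [hQ₂, Complex.zero_re] at hlim₂
  obtain ⟨ns, hns, hlim₁⟩ :=
    exists_subseq_tendsto_integral_of_absolutelyContinuous hμ hgm hg0 hg3 hlim₂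
  have hre : (𝓕.Φ ρ₁ Q).re = 0 :=
    tendsto_nhds_unique ((hlim hb₁ hZ₁).comp hns.tendsto_atTop) hlim₁
  have hnn : 0 ≤ 𝓕.Φ ρ₁ Q := by
    have := (𝓕.Φ_normal ρ₁).nonneg Q
    rwa [hQp.isSelfAdjoint.star_eq, hQp.isIdempotentElem.eq] at this
  exact Complex.ext hre (Complex.le_def.mp hnn).2.symm

end QuantumFiltering

end

theorem mainTheorem5 {A : Type*} [CStarAlgebra A] [PartialOrder A] [StarOrderedRing A]
    {H : Type*} [NormedAddCommGroup H] [InnerProductSpace ℂ H] [CompleteSpace H] {n : ℕ}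
    (𝓕 : QuantumFiltering.FilteringModel A H n) (ρ₁ ρ₂ : QuantumFiltering.stateSpace A)
    (h : QuantumFiltering.StateAbsolutelyContinuous ρ₁ ρ₂) :
    𝓕.ObsLawAbsolutelyContinuous ρ₁ ρ₂ := by
  exact 𝓕.obsLawAbsolutelyContinuous h
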